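/- For a finite simple graph $G$ and a real number $\alpha$, let $\chi_\alpha(G)=\sum_{uv\in E(G)}(d(u)+d(v))^\alpha$ be the general sum-connectivity index, where $d(v)$ denotes the degree of $v$. A graph is unicyclic if it is connected and contains exactly one cycle. Attaching a path with $r\ge 1$ vertices to a vertex $v$ of a graph means adding a disjoint path with $r$ vertices and an edge joining $v$ to a terminal vertex of this path; for $r=1$ this is attaching a pendant vertex. Graphs are considered up to isomorphism. The second maximum of $\chi_\alpha$ on a class of graphs is the second largest of the distinct values that it takes on the class. Let $-1\le\alpha<0$ and $n\ge 4$. 1. Among the unicyclic graphs on $n$ vertices, the cycle $C_n$ is the unique graph with maximum $\chi_\alpha$, and the maximum equals $n\,4^\alpha$. 2. If $n=4$, then the second maximum of $\chi_\alpha$ among the unicyclic graphs on $n$ vertices equals $2\cdot 4^\alpha+2\cdot 5^\alpha$, and it is attained by exactly one graph, namely the graph $U_{4,3}$ obtained by attaching a pendant vertex to a vertex of a triangle. 3. If $n\ge 5$, then the second maximum of $\chi_\alpha$ among the unicyclic graphs on $n$ vertices equals $(n-4)4^\alpha+3\cdot 5^\alpha+3^\alpha$, and the graphs attaining it are exactly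 the $n$-vertex graphs obtained from a cycle $C_l$ by attaching a path with $r$ vertices to one of its vertices, where $l\ge 3$, $r\ge 2$ and $l+r=n$. -/

import Mathlib

/-- A graph is unicyclic if it is connected and contains exactly one cycle. Cycles are counted as
subgraphs, so that the starting point and the orientation of a closed walk play no role. -/
def SimpleGraph.IsUnicyclic {V : Type*} (G : SimpleGraph V) : Prop :=
  G.Connected ∧
    ∃! C : G.Subgraph, ∃ (v : V) (p : G.Walk v v), p.IsCycle ∧ p.toSubgraph = C

open Classical in
/-- The general sum-connectivity index: the sum over the edges `uv` of `(d(u) + d(v)) ^ α`. -/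
noncomputable def SimpleGraph.sumConnectivity {V : Type*} [Fintype V] (α : ℝ)
    (G : SimpleGraph V) : ℝ :=
  ∑ e ∈ G.edgeFinset,
    Sym2.lift ⟨fun u v => ((G.degree u : ℝ) + (G.degree v : ℝ)) ^ α,
      fun u v => by simp only [add_comm]⟩ e

/-- The graph obtained from `G` by attaching the path with `r` vertices to the vertex `v`: a
disjoint copy of the path is added, and one of its terminal vertices is joined to `v`.
For `r = 1` this attaches a pendant vertex to `v`. -/
def SimpleGraph.attachPath {V : Type*} (G : SimpleGraph V) (v : V) (r : ℕ) :
    SimpleGraph (V ⊕ Fin r) where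
  Adj x y := match x, y with
    | Sum.inl u, Sum.inl w => G.Adj u w
    | Sum.inr i, Sum.inr j => (SimpleGraph.pathGraph r).Adj i j
    | Sum.inl u, Sum.inr i => u = v ∧ i.val = 0
    | Sum.inr i, Sum.inl u => u = v ∧ i.val = 0
  symm := ⟨by
    rintro (u | i) (w | j) h
    · exact G.symm.symm _ _ h
    · exact h
    · exact h
    · exact (SimpleGraph.pathGraph r).symm.symm _ _ h⟩
  loopless := ⟨by
    rintro (u | i) h
    · exact G.loopless.irrefl u h
    · exact (SimpleGraph.pathGraph r).loopless.irrefl i h⟩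

/-- The set of values of the index on the unicyclic graphs with vertex set `V`. -/
def unicyclicIndexValues (V : Type*) [Fintype V] (α : ℝ) : Set ℝ :=
  {x | ∃ G : SimpleGraph V, G.IsUnicyclic ∧ G.sumConnectivity α = x}

/-- `b` is the second largest element of `S`: the largest one once the maximum is removed. -/
def IsSecondGreatest (S : Set ℝ) (b : ℝ) : Prop :=
  ∃ a, IsGreatest S a ∧ IsGreatest (S \ {a}) b

/-! Each edge term is compared with an affine function of `1 / x + 1 / y`, with coefficients chosen
so that equality holds at the degree pairs (2, 2) and (1, 2). Summed over all edges, `1 / d(u) + 1 /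
d(v)` counts every vertex once, so it equals the number of vertices. A unicyclic graph has as many
edges as vertices, so the affine corrections cancel, and the index is `n * 4 ^ α` minus the total
slack (`sumConnectivity_eq_sub`).

The slack vanishes at (1, 2) and (2, 2), and is at least `edgeGap α 3 2 > 0` once an end has degree
at least three, with equality only at (3, 2) (`edgeGap_three_two_le`, `edgeGap_three_two_lt`). Since
the degrees average two, either all of them equal two and the graph is a cycle, or some vertex of
degree at least three costs at least `3 * edgeGap α 3 2`. Equality forces a single vertex of degree
three, with all its neighbors of degree two. Following a longest path from the only leaf then
identifies the graph as a cycle with an attached path of at least two vertices.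

This equality case needs five vertices. On four vertices the only unicyclic graph besides the cycle
is the triangle with a pendant vertex, and its value is computed directly. -/

/-! ### The edge inequality -/

/-- The slack of the edge inequality
`(x + y) ^ α ≤ 4 ^ α + 2 (3 ^ α - 4 ^ α) (1 / x + 1 / y - 1)`; summed over the edges of a graph with
as many edges as vertices and without isolated vertices, it measures the distance of the
sum-connectivity index from `n * 4 ^ α`. -/
noncomputable def edgeGap (α x y : ℝ) : ℝ :=
  4 ^ α + 2 * (3 ^ α - 4 ^ α) * (1 / x + 1 / y - 1) - (x + y) ^ α

lemma edgeGap_comm (α x y : ℝ) : edgeGap α x y = edgeGap α y x := by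
  simp only [edgeGap, add_comm x y, add_comm (1 / x) (1 / y)]

lemma edgeGap_two_two (α : ℝ) : edgeGap α 2 2 = 0 := by
  simp only [edgeGap]; norm_num

lemma edgeGap_one_two (α : ℝ) : edgeGap α 1 2 = 0 := by
  simp only [edgeGap]; norm_num; ring

lemma edgeGap_three_two (α : ℝ) :
    edgeGap α 3 2 = 4 ^ α - 5 ^ α - (3 ^ α - 4 ^ α) / 3 := by
  simp only [edgeGap]; norm_num; ring

lemma edgeGap_three_one (α : ℝ) : edgeGap α 3 1 = 2 * (3 ^ α - 4 ^ α) / 3 := by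
  simp only [edgeGap]; norm_num; ring

/-- Bernoulli's inequality for the exponent `-α`, which lies in (0, 1], applied to `(y / x) ^ (-α)`.
It is the main source of the numerical estimates below. -/
lemma Real.rpow_le_rpow_mul_bernoulli {α x y : ℝ} (hα : -1 ≤ α) (hα0 : α < 0) (hx : 0 < x)
    (hy : 0 < y) : x ^ α ≤ y ^ α * (1 - α * (y / x - 1)) := by
  have h1 : x ^ α = y ^ α * (1 + (y / x - 1)) ^ (-α) := by
    rw [add_sub_cancel, Real.rpow_neg (by positivity), Real.div_rpow hy.le hx.le]
    have := Real.rpow_pos_of_pos hy α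
    have := Real.rpow_pos_of_pos hx α
    field_simp
  have h2 := rpow_one_add_le_one_add_mul_self (s := y / x - 1) (p := -α)
    (by have := div_pos hy hx; linarith) (by linarith) (by linarith)
  rw [h1]
  refine mul_le_mul_of_nonneg_left ?_ (Real.rpow_nonneg hy.le α)
  linarith

section
variable {α : ℝ}

lemma rpow_four_lt_rpow_three (hα0 : α < 0) : (4 : ℝ) ^ α < 3 ^ α :=
  Real.rpow_lt_rpow_of_neg (by norm_num) (by norm_num) hα0

/-- Since 15 < 16, the product of `3 ^ α` and `5 ^ α` exceeds the square of `4 ^ α`; then use the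
inequality of arithmetic and geometric means. -/
lemma two_mul_rpow_four_lt (hα0 : α < 0) : 2 * (4 : ℝ) ^ α < 3 ^ α + 5 ^ α := by
  have h : (4 : ℝ) ^ α * 4 ^ α < 3 ^ α * 5 ^ α := by
    rw [← Real.mul_rpow (by norm_num) (by norm_num), ← Real.mul_rpow (by norm_num) (by norm_num)]
    exact Real.rpow_lt_rpow_of_neg (by norm_num) (by norm_num) hα0
  have h3 := Real.rpow_pos_of_pos (show (0 : ℝ) < 3 by norm_num) α
  have h5 := Real.rpow_pos_of_pos (show (0 : ℝ) < 5 by norm_num) α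
  nlinarith [sq_nonneg ((3 : ℝ) ^ α - 5 ^ α)]

/-- This is `edgeGap α 3 2 < edgeGap α 3 3` cleared of denominators. By Bernoulli the left side is
at most `-α / 3 * 4 ^ α`, the right side at least `-α / 2 * 5 ^ α`, and `4 ^ α ≤ 5 / 4 * 5 ^ α`. -/
lemma rpow_three_sub_rpow_four_lt (hα : -1 ≤ α) (hα0 : α < 0) :
    (3 : ℝ) ^ α - 4 ^ α < 3 * (5 ^ α - 6 ^ α) := by
  have h1 := Real.rpow_le_rpow_mul_bernoulli hα hα0 (x := 3) (y := 4) (by norm_num) (by norm_num)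
  have h2 := Real.rpow_le_rpow_mul_bernoulli hα hα0 (x := 6) (y := 5) (by norm_num) (by norm_num)
  have h3 := Real.rpow_le_rpow_mul_bernoulli hα hα0 (x := 4) (y := 5) (by norm_num) (by norm_num)
  have h5 := Real.rpow_pos_of_pos (show (0 : ℝ) < 5 by norm_num) α
  have h6 : (4 : ℝ) ^ α ≤ 5 / 4 * 5 ^ α := by nlinarith
  nlinarith

lemma edgeGap_three_two_pos (hα : -1 ≤ α) (hα0 : α < 0) : 0 < edgeGap α 3 2 := by
  rw [edgeGap_three_two]
  have h1 := Real.rpow_le_rpow_mul_bernoulli hα hα0 (x := 3) (y := 4) (by norm_num) (by norm_num)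
  have h2 := Real.rpow_le_rpow_mul_bernoulli hα hα0 (x := 5) (y := 4) (by norm_num) (by norm_num)
  have h4 := Real.rpow_pos_of_pos (show (0 : ℝ) < 4 by norm_num) α
  nlinarith [mul_pos h4 (neg_pos.2 hα0)]

lemma edgeGap_three_two_lt_of_six_le (hα : -1 ≤ α) (hα0 : α < 0) {x y : ℝ} (hx : 0 < x)
    (hy : 0 < y) (hxy : 6 ≤ x + y) : edgeGap α 3 2 < edgeGap α x y := by
  have hK := rpow_three_sub_rpow_four_lt hα hα0
  have hc := rpow_four_lt_rpow_three hα0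
  -- For a fixed sum, `1 / x + 1 / y` is least at `x = y`, which gives `2 / 3 * t`. At `t = 1` the
  -- bound is the slack at (3, 3); as `t` decreases, the drop of `(x + y) ^ α` outweighs the loss in
  -- the affine term (`hs`).
  set t := 6 / (x + y) with ht
  have ht1 : t ≤ 1 := by rw [ht, div_le_one (by linarith)]; exact hxy
  have hinv : 2 / 3 * t ≤ 1 / x + 1 / y := by
    rw [ht, div_add_div _ _ hx.ne' hy.ne', ← mul_div_assoc,
      div_le_div_iff₀ (by positivity) (by positivity)]
    nlinarith [sq_nonneg (x - y)]
  have h1 := Real.rpow_le_rpow_mul_bernoulli hα hα0 (x := 3) (y := 4) (by norm_num) (by norm_num)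
  have h2 := Real.rpow_le_rpow_mul_bernoulli hα hα0 (x := x + y) (y := 6)
    (by linarith) (by norm_num)
  have h3 := Real.rpow_le_rpow_mul_bernoulli hα hα0 (x := 4) (y := 6) (by norm_num) (by norm_num)
  have h6 := Real.rpow_pos_of_pos (show (0 : ℝ) < 6 by norm_num) α
  have h46 : (4 : ℝ) ^ α ≤ 3 / 2 * 6 ^ α := by nlinarith
  rw [← ht] at h2
  have h34 : (3 : ℝ) ^ α - 4 ^ α ≤ -α / 2 * 6 ^ α := by nlinarith
  have hs : 4 / 3 * (3 ^ α - 4 ^ α) * (1 - t) ≤ 6 ^ α - (x + y) ^ α := by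
    have := mul_le_mul_of_nonneg_right h34 (sub_nonneg.2 ht1)
    have := mul_nonneg (mul_pos (neg_pos.2 hα0) h6).le (sub_nonneg.2 ht1)
    nlinarith
  rw [edgeGap_three_two, edgeGap]
  have := mul_le_mul_of_nonneg_left hinv (sub_nonneg.2 hc.le)
  nlinarith

lemma edgeGap_three_two_lt (hα : -1 ≤ α) (hα0 : α < 0) {a b : ℕ} (ha : 3 ≤ a) (hb : 1 ≤ b)
    (hab : ¬ (a = 3 ∧ b = 2)) : edgeGap α 3 2 < edgeGap α a b := by
  by_cases h6 : 6 ≤ a + b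
  · exact edgeGap_three_two_lt_of_six_le hα hα0 (by positivity) (by positivity)
      (by exact_mod_cast h6)
  have hc := rpow_four_lt_rpow_three hα0
  have h4 := two_mul_rpow_four_lt hα0
  obtain ⟨rfl, rfl⟩ | ⟨rfl, rfl⟩ : (a = 3 ∧ b = 1) ∨ (a = 4 ∧ b = 1) := by omega
  · push_cast
    rw [edgeGap_three_two, edgeGap_three_one]
    linarith
  · rw [edgeGap_three_two]
    simp only [edgeGap]
    norm_num
    linarith

lemma edgeGap_three_two_le (hα : -1 ≤ α) (hα0 : α < 0) {a b : ℕ} (ha : 3 ≤ a) (hb : 1 ≤ b) :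
    edgeGap α 3 2 ≤ edgeGap α a b := by
  by_cases hab : a = 3 ∧ b = 2
  · rw [hab.1, hab.2]; norm_num
  · exact (edgeGap_three_two_lt hα hα0 ha hb hab).le

/-- The pair (1, 1) must be excluded: its slack `2 * 3 ^ α - 4 ^ α - 2 ^ α` is negative by
convexity. -/
lemma edgeGap_eq_zero {a b : ℕ} (ha : 1 ≤ a) (hb : 1 ≤ b) (ha2 : a ≤ 2) (hb2 : b ≤ 2)
    (hab : ¬ (a = 1 ∧ b = 1)) : edgeGap α a b = 0 := by
  obtain ⟨rfl, rfl⟩ | ⟨rfl, rfl⟩ | ⟨rfl, rfl⟩ :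
    (a = 2 ∧ b = 2) ∨ (a = 1 ∧ b = 2) ∨ (a = 2 ∧ b = 1) := by omega
  · exact_mod_cast edgeGap_two_two α
  · exact_mod_cast edgeGap_one_two α
  · rw [edgeGap_comm]; exact_mod_cast edgeGap_one_two α

lemma edgeGap_nonneg (hα : -1 ≤ α) (hα0 : α < 0) {a b : ℕ} (ha : 1 ≤ a) (hb : 1 ≤ b)
    (hab : ¬ (a = 1 ∧ b = 1)) : 0 ≤ edgeGap α a b := by
  have h := edgeGap_three_two_pos hα hα0
  by_cases h3 : 3 ≤ a
  · exact h.le.trans (edgeGap_three_two_le hα hα0 h3 hb)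
  by_cases h3' : 3 ≤ b
  · rw [edgeGap_comm]; exact h.le.trans (edgeGap_three_two_le hα hα0 h3' ha)
  · exact (edgeGap_eq_zero ha hb (by omega) (by omega) hab).ge
end

/-! ### Unicyclic graphs by edge count -/

namespace SimpleGraph

variable {V : Type*} {G : SimpleGraph V}

/-- A connected graph with as many edges as vertices becomes a tree when an edge of a cycle is
deleted. -/
lemma Connected.isTree_deleteEdges [Finite V] (hG : G.Connected)
    (hcard : Nat.card G.edgeSet = Nat.card V) {v : V} {p : G.Walk v v} (hp : p.IsCycle)
    {e : Sym2 V} (he : e ∈ p.edges) : (G.deleteEdges {e}).IsTree := by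
  have heG := p.edges_subset_edgeSet he
  have hb : ¬ G.IsBridge e := fun h => h.notMem_edges_of_isCycle hp he
  rw [isTree_iff_connected_and_card]
  refine ⟨?_, ?_⟩
  · induction e with
    | h x y => exact hG.connected_delete_edge_of_not_isBridge hb
  · rw [edgeSet_deleteEdges, Nat.card_coe_set_eq, Set.ncard_sdiff_singleton_add_one heG,
      ← Nat.card_coe_set_eq, hcard]

/-- A cycle is not the trivial walk, so each of its vertices lies on one of its edges and the edges
determine the subgraph. -/
lemma Walk.IsCycle.toSubgraph_eq_of_edges_subset {u v : V} {p : G.Walk u u} {q : G.Walk v v}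
    (hp : p.IsCycle) (hq : q.IsCycle) (hpq : p.edges ⊆ q.edges) (hqp : q.edges ⊆ p.edges) :
    p.toSubgraph = q.toSubgraph := by
  have key : ∀ {u v : V} {p : G.Walk u u} {q : G.Walk v v}, p.IsCycle → p.edges ⊆ q.edges →
      p.toSubgraph ≤ q.toSubgraph := by
    intro u v p q hp h
    rw [Walk.toSubgraph_le_iff hp.not_nil]
    intro e he
    exact (Walk.mem_edges_toSubgraph q).2 (h he)
  exact le_antisymm (key hp hpq) (key hq hqp)

/-- A finite graph is unicyclic if and only if it is connected with as many edges as vertices. -/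
theorem isUnicyclic_iff [Finite V] :
    G.IsUnicyclic ↔ G.Connected ∧ Nat.card G.edgeSet = Nat.card V := by
  constructor
  · rintro ⟨hG, C, ⟨v, p, hp, rfl⟩, huniq⟩
    refine ⟨hG, ?_⟩
    obtain ⟨e, he⟩ : ∃ e, e ∈ p.edges := by
      refine List.exists_mem_of_length_pos ?_
      rw [Walk.length_edges]; have := hp.three_le_length; omega
    have heG := p.edges_subset_edgeSet he
    have hb : ¬ G.IsBridge e := fun h => h.notMem_edges_of_isCycle hp he
    have hT : (G.deleteEdges {e}).IsTree := by
      refine ⟨?_, fun w c hc => ?_⟩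
      · induction e with
        | h x y => exact hG.connected_delete_edge_of_not_isBridge hb
      · have hle := deleteEdges_le (G := G) {e}
        -- A cycle surviving the deletion of `e` would be the unique cycle of `G`, which contains
        -- `e`.
        have h := huniq _ ⟨w, c.mapLe hle, hc.mapLe hle, rfl⟩
        have he' : e ∈ (c.mapLe hle).edges := by
          rw [← Walk.mem_edges_toSubgraph, h, Walk.mem_edges_toSubgraph]; exact he
        rw [Walk.edges_mapLe_eq_edges] at he'
        have := c.edges_subset_edgeSet he'
        simp [edgeSet_deleteEdges] at this
    rw [isTree_iff_connected_and_card, edgeSet_deleteEdges, Nat.card_coe_set_eq,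
      Set.ncard_sdiff_singleton_add_one heG, ← Nat.card_coe_set_eq] at hT
    exact hT.2
  · rintro ⟨hG, hcard⟩
    refine ⟨hG, ?_⟩
    have hnt : ¬ G.IsAcyclic := by
      intro h
      have := (isTree_iff_connected_and_card.1 ⟨hG, h⟩).2
      omega
    simp only [IsAcyclic, not_forall, not_not] at hnt
    obtain ⟨v, p, hp⟩ := hnt
    -- If `q` missed an edge of `p`, it would survive in the tree left by deleting that edge.
    have key : ∀ {u v : V} {p : G.Walk u u} {q : G.Walk v v}, p.IsCycle → q.IsCycle →
        p.edges ⊆ q.edges := by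
      intro u v p q hp hq e he
      by_contra heq
      exact (hG.isTree_deleteEdges hcard hp he).isAcyclic _
        (hq.toDeleteEdges G {e} fun e' he' h => heq ((Set.mem_singleton_iff.1 h) ▸ he'))
    refine ⟨p.toSubgraph, ⟨v, p, hp, rfl⟩, ?_⟩
    rintro _ ⟨w, q, hq, rfl⟩
    exact hq.toSubgraph_eq_of_edges_subset hp (key hq hp) (key hp hq)

end SimpleGraph

/-! ### The index as total slack, and its equality case -/

namespace SimpleGraph

section
open Classical
variable {V : Type*} [Fintype V] (G : SimpleGraph V)

lemma sum_incidenceFinset {M : Type*} [AddCommMonoid M] (v : V) (F : Sym2 V → M) :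
    ∑ e ∈ G.incidenceFinset v, F e = ∑ w ∈ G.neighborFinset v, F s(v, w) := by
  symm
  refine Finset.sum_bij (fun w _ => s(v, w)) ?_ ?_ ?_ (fun _ _ => rfl)
  · intro w hw
    rw [mem_incidenceFinset, mk'_mem_incidenceSet_iff]
    exact ⟨(G.mem_neighborFinset v w).1 hw, Or.inl rfl⟩
  · intro a _ b _ h
    exact Sym2.congr_right.1 h
  · intro e he
    rw [mem_incidenceFinset] at he
    obtain ⟨w, rfl⟩ := he.2
    exact ⟨w, (G.mem_neighborFinset v w).2 he.1, rfl⟩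

lemma sum_edgeFinset_ite {M : Type*} [AddCommMonoid M] (f : V → M) :
    ∑ e ∈ G.edgeFinset, ∑ v, (if v ∈ e then f v else 0) = ∑ v, G.degree v • f v := by
  rw [Finset.sum_comm]
  refine Finset.sum_congr rfl fun v _ => ?_
  rw [← Finset.sum_filter, ← incidenceFinset_eq_filter, Finset.sum_const,
    card_incidenceFinset_eq_degree]

/-- The slack of the edge inequality at the edges of `G`, as a function on unordered pairs. -/
noncomputable def degreeGap (α : ℝ) : Sym2 V → ℝ :=
  Sym2.lift ⟨fun u v => edgeGap α (G.degree u) (G.degree v), fun _ _ => edgeGap_comm _ _ _⟩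

@[simp] lemma degreeGap_mk (α : ℝ) (u v : V) :
    G.degreeGap α s(u, v) = edgeGap α (G.degree u) (G.degree v) := rfl

variable {G}

/-- Double counting: a vertex of degree `d` contributes `1 / d` at each of its `d` edges, so the
affine corrections sum to a multiple of vertices minus edges, which is zero. -/
lemma sumConnectivity_eq_sub (α : ℝ) (hpos : ∀ v, 0 < G.degree v)
    (hcard : G.edgeFinset.card = Fintype.card V) :
    G.sumConnectivity α = Fintype.card V * 4 ^ α - ∑ e ∈ G.edgeFinset, G.degreeGap α e := by
  have hinv : ∑ e ∈ G.edgeFinset, ∑ v, (if v ∈ e then 1 / (G.degree v : ℝ) else 0) =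
      Fintype.card V := by
    rw [sum_edgeFinset_ite]
    have : ∀ v, G.degree v • (1 / (G.degree v : ℝ)) = 1 := by
      intro v
      have := hpos v
      rw [nsmul_eq_mul]; field_simp
    rw [Finset.sum_congr rfl fun v _ => this v]
    simp
  have hedge : ∀ e ∈ G.edgeFinset,
      Sym2.lift ⟨fun u v => ((G.degree u : ℝ) + (G.degree v : ℝ)) ^ α,
        fun u v => by simp only [add_comm]⟩ e = 4 ^ α + 2 * (3 ^ α - 4 ^ α) *
        ((∑ v, (if v ∈ e then 1 / (G.degree v : ℝ) else 0)) - 1) - G.degreeGap α e := by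
    intro e he
    induction e with
    | h x y =>
      have hxy : x ≠ y := (mem_edgeFinset.1 he : G.Adj x y).ne
      have : ∑ v, (if v ∈ s(x, y) then 1 / (G.degree v : ℝ) else 0) =
          1 / (G.degree x : ℝ) + 1 / (G.degree y : ℝ) := by
        rw [← Finset.sum_filter, ← Finset.sum_pair (f := fun v => 1 / (G.degree v : ℝ)) hxy]
        refine Finset.sum_congr ?_ fun _ _ => rfl
        ext v; simp
      rw [this, degreeGap_mk, Sym2.lift_mk, edgeGap]
      ring
  rw [sumConnectivity, Finset.sum_congr rfl hedge, Finset.sum_sub_distrib, Finset.sum_add_distrib,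
    ← Finset.mul_sum, Finset.sum_sub_distrib, hinv]
  simp [hcard]

/-- In a connected graph, a nonempty set of vertices closed under adjacency is everything. -/
lemma Connected.mem_of_adj_closed {V : Type*} {G : SimpleGraph V} (hG : G.Connected) {s : Set V}
    {a : V} (ha : a ∈ s) (hs : ∀ x ∈ s, ∀ y, G.Adj x y → y ∈ s) (b : V) : b ∈ s := by
  obtain ⟨p⟩ := hG.preconnected a b
  induction p with
  | nil => exact ha
  | cons h _ ih => exact ih (hs _ ha _ h)

lemma Connected.degree_pos' (hG : G.Connected) (hn : 2 ≤ Fintype.card V) (v : V) :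
    0 < G.degree v := by
  have : Nontrivial V := Fintype.one_lt_card_iff_nontrivial.1 hn
  exact hG.preconnected.degree_pos_of_nontrivial v

/-- The two ends of such an edge would form a whole component. This rules out the only degree pair
with negative slack. -/
lemma Connected.not_degree_one_one (hG : G.Connected) (hn : 3 ≤ Fintype.card V) {u v : V}
    (huv : G.Adj u v) : ¬ (G.degree u = 1 ∧ G.degree v = 1) := by
  rintro ⟨hu, hv⟩
  rw [← card_neighborFinset_eq_degree, Finset.card_eq_one] at hu hv
  obtain ⟨a, ha⟩ := hu
  obtain ⟨b, hb⟩ := hv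
  have hau : ∀ y, G.Adj u y → y = v := by
    intro y hy
    have h1 : y ∈ ({a} : Finset V) := ha ▸ (G.mem_neighborFinset u y).2 hy
    have h2 : v ∈ ({a} : Finset V) := ha ▸ (G.mem_neighborFinset u v).2 huv
    rw [Finset.mem_singleton] at h1 h2; rw [h1, h2]
  have hbv : ∀ y, G.Adj v y → y = u := by
    intro y hy
    have h1 : y ∈ ({b} : Finset V) := hb ▸ (G.mem_neighborFinset v y).2 hy
    have h2 : u ∈ ({b} : Finset V) := hb ▸ (G.mem_neighborFinset v u).2 huv.symm
    rw [Finset.mem_singleton] at h1 h2; rw [h1, h2]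
  have hall : ∀ x, x ∈ ({u, v} : Set V) := by
    refine hG.mem_of_adj_closed (a := u) (by simp) ?_
    rintro x (rfl | rfl) y hy
    · right; exact hau y hy
    · left; exact hbv y hy
  have : Fintype.card V ≤ ({u, v} : Finset V).card := by
    rw [← Finset.card_univ]
    exact Finset.card_le_card fun x _ => by simpa using hall x
  have := Finset.card_le_two (a := u) (b := v)
  omega

variable {α : ℝ}

lemma Connected.degreeGap_nonneg (hα : -1 ≤ α) (hα0 : α < 0) (hG : G.Connected)
    (hn : 3 ≤ Fintype.card V) {e : Sym2 V} (he : e ∈ G.edgeFinset) : 0 ≤ G.degreeGap α e := by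
  induction e with
  | h x y =>
    exact edgeGap_nonneg hα hα0 (hG.degree_pos' (by omega) x) (hG.degree_pos' (by omega) y)
      (hG.not_degree_one_one hn (mem_edgeFinset.1 he))

lemma three_mul_edgeGap_le_sum (hα : -1 ≤ α) (hα0 : α < 0) (hpos : ∀ v, 0 < G.degree v) {v : V}
    (hv : 3 ≤ G.degree v) :
    3 * edgeGap α 3 2 ≤ ∑ e ∈ G.incidenceFinset v, G.degreeGap α e := by
  have h0 := edgeGap_three_two_pos hα hα0
  rw [sum_incidenceFinset]
  calc 3 * edgeGap α 3 2 ≤ G.degree v * edgeGap α 3 2 := by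
        gcongr; exact_mod_cast hv
    _ = ∑ w ∈ G.neighborFinset v, edgeGap α 3 2 := by simp
    _ ≤ _ := Finset.sum_le_sum fun w _ => edgeGap_three_two_le hα hα0 hv (hpos w)

lemma degree_eq_of_sum_incidenceFinset_le (hα : -1 ≤ α) (hα0 : α < 0)
    (hpos : ∀ v, 0 < G.degree v) {v : V} (hv : 3 ≤ G.degree v)
    (hle : ∑ e ∈ G.incidenceFinset v, G.degreeGap α e ≤ 3 * edgeGap α 3 2) :
    G.degree v = 3 ∧ ∀ w, G.Adj v w → G.degree w = 2 := by
  have h0 := edgeGap_three_two_pos hα hα0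
  rw [sum_incidenceFinset] at hle
  have hlow : ∑ w ∈ G.neighborFinset v, edgeGap α 3 2 ≤
      ∑ w ∈ G.neighborFinset v, G.degreeGap α s(v, w) :=
    Finset.sum_le_sum fun w _ => edgeGap_three_two_le hα hα0 hv (hpos w)
  have hconst : ∑ w ∈ G.neighborFinset v, edgeGap α 3 2 = G.degree v * edgeGap α 3 2 := by simp
  have h3 : G.degree v = 3 := by
    have : (G.degree v : ℝ) ≤ 3 := le_of_mul_le_mul_right (by linarith) h0
    exact le_antisymm (by exact_mod_cast this) hv
  refine ⟨h3, fun w hw => ?_⟩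
  by_contra h2
  have hlt : ∑ w ∈ G.neighborFinset v, edgeGap α 3 2 <
      ∑ w ∈ G.neighborFinset v, G.degreeGap α s(v, w) :=
    Finset.sum_lt_sum (fun w _ => edgeGap_three_two_le hα hα0 hv (hpos w))
      ⟨w, (G.mem_neighborFinset v w).2 hw,
        edgeGap_three_two_lt hα hα0 hv (hpos w) fun h => h2 h.2⟩
  rw [hconst, h3] at hlt
  push_cast at hlt
  linarith

lemma sum_edgeFinset_degreeGap_eq_sum_incidenceFinset (hG : G.Connected)
    (hn : 3 ≤ Fintype.card V) {v : V} (hv : ∀ u, u ≠ v → G.degree u ≤ 2) :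
    ∑ e ∈ G.edgeFinset, G.degreeGap α e = ∑ e ∈ G.incidenceFinset v, G.degreeGap α e := by
  symm
  refine Finset.sum_subset (G.incidenceFinset_subset v) fun e he hev => ?_
  induction e with
  | h x y =>
    have hxy : G.Adj x y := mem_edgeFinset.1 he
    rw [mem_incidenceFinset, mk'_mem_incidenceSet_iff] at hev
    push Not at hev
    have := hev hxy
    exact edgeGap_eq_zero (hG.degree_pos' (by omega) x) (hG.degree_pos' (by omega) y)
      (hv x this.1.symm) (hv y this.2.symm) (hG.not_degree_one_one hn hxy)

lemma sum_incidenceFinset_degreeGap_le (hα : -1 ≤ α) (hα0 : α < 0) (hG : G.Connected)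
    (hn : 3 ≤ Fintype.card V) (v : V) :
    ∑ e ∈ G.incidenceFinset v, G.degreeGap α e ≤ ∑ e ∈ G.edgeFinset, G.degreeGap α e :=
  Finset.sum_le_sum_of_subset_of_nonneg (G.incidenceFinset_subset v)
    fun _ he _ => hG.degreeGap_nonneg hα hα0 hn he

/-- If the total slack is that of a single vertex of degree three with neighbors of degree two,
then the degrees are as described. -/
lemma degree_eq_of_sum_edgeFinset_le (hα : -1 ≤ α) (hα0 : α < 0) (hG : G.Connected)
    (hn : 3 ≤ Fintype.card V) {v : V} (hv : 3 ≤ G.degree v)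
    (hle : ∑ e ∈ G.edgeFinset, G.degreeGap α e ≤ 3 * edgeGap α 3 2) :
    G.degree v = 3 ∧ (∀ w, G.Adj v w → G.degree w = 2) ∧ ∀ u, u ≠ v → G.degree u ≤ 2 := by
  have hpos := hG.degree_pos' (by omega)
  have h0 := edgeGap_three_two_pos hα hα0
  obtain ⟨h3, h2⟩ := degree_eq_of_sum_incidenceFinset_le hα hα0 hpos hv
    ((sum_incidenceFinset_degreeGap_le hα hα0 hG hn v).trans hle)
  refine ⟨h3, h2, fun u huv => ?_⟩
  by_contra! hu
  obtain ⟨w, huw⟩ : ∃ w, G.Adj u w := (G.degree_pos_iff_exists_adj u).1 (hpos u)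
  -- Neighbors of `v` have degree two, so `u` is not one of them, and any edge at `u` adds positive
  -- slack beyond that at `v`.
  have hnot : s(u, w) ∉ G.incidenceFinset v := by
    rw [mem_incidenceFinset, mk'_mem_incidenceSet_iff]
    rintro ⟨-, rfl | rfl⟩
    · exact huv rfl
    · have := h2 u huw.symm; omega
  have hlt : ∑ e ∈ G.incidenceFinset v, G.degreeGap α e < ∑ e ∈ G.edgeFinset, G.degreeGap α e :=
    Finset.sum_lt_sum_of_subset (G.incidenceFinset_subset v) (mem_edgeFinset.2 huw) hnot
      (h0.trans_le (edgeGap_three_two_le hα hα0 hu (hpos w)))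
      fun _ he _ => hG.degreeGap_nonneg hα hα0 hn he
  have := three_mul_edgeGap_le_sum hα hα0 hpos hv
  linarith

end
end SimpleGraph

/-! ### Cycles with attached paths, and longest paths -/

namespace SimpleGraph

section
open Classical

/-- An injective homomorphism from a graph on a nonempty vertex set into a connected graph which
does not increase degrees is an isomorphism. -/
lemma Connected.nonempty_iso_of_injective {V W : Type*} [Fintype V] [Fintype W] [Nonempty W]
    {G : SimpleGraph V} {H : SimpleGraph W} (hG : G.Connected) (f : H →g G)
    (hf : Function.Injective f) (hdeg : ∀ a, G.degree (f a) ≤ H.degree a) :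
    Nonempty (G ≃g H) := by
  -- By the degree bound, `f` maps each neighborhood onto the full neighborhood. Hence the range is
  -- closed under adjacency, so it is everything, and adjacency is reflected.
  have himg : ∀ a, (H.neighborFinset a).image f = G.neighborFinset (f a) := by
    intro a
    refine Finset.eq_of_subset_of_card_le ?_ ?_
    · intro y hy
      obtain ⟨b, hb, rfl⟩ := Finset.mem_image.1 hy
      rw [mem_neighborFinset] at hb ⊢
      exact f.map_adj hb
    · rw [Finset.card_image_of_injective _ hf, card_neighborFinset_eq_degree,
        card_neighborFinset_eq_degree]
      exact hdeg a
  have hlift : ∀ a y, G.Adj (f a) y → ∃ b, H.Adj a b ∧ f b = y := by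
    intro a y hy
    have := (G.mem_neighborFinset (f a) y).2 hy
    rw [← himg, Finset.mem_image] at this
    obtain ⟨b, hb, rfl⟩ := this
    exact ⟨b, (H.mem_neighborFinset a b).1 hb, rfl⟩
  have hsurj : Function.Surjective f := by
    obtain ⟨a₀⟩ := ‹Nonempty W›
    refine hG.mem_of_adj_closed (s := Set.range f) ⟨a₀, rfl⟩ ?_
    rintro _ ⟨a, rfl⟩ y hy
    obtain ⟨b, -, hb⟩ := hlift a y hy
    exact ⟨b, hb⟩
  refine ⟨RelIso.symm ⟨Equiv.ofBijective f ⟨hf, hsurj⟩, ?_⟩⟩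
  intro a b
  refine ⟨fun h => ?_, fun h => f.map_adj h⟩
  obtain ⟨b', hb', he⟩ := hlift a (f b) h
  exact hf he ▸ hb'

lemma degree_eq_sum_ite {V : Type*} [Fintype V] (G : SimpleGraph V) (v : V) :
    G.degree v = ∑ w, if G.Adj v w then 1 else 0 := by
  rw [← card_neighborFinset_eq_degree, neighborFinset_eq_filter, Finset.card_filter]

section attachPath
variable {V : Type*} {H : SimpleGraph V} {v : V} {r : ℕ}

@[simp] lemma attachPath_adj_inl_inl {a b : V} :
    (H.attachPath v r).Adj (Sum.inl a) (Sum.inl b) ↔ H.Adj a b := Iff.rfl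

@[simp] lemma attachPath_adj_inl_inr {a : V} {i : Fin r} :
    (H.attachPath v r).Adj (Sum.inl a) (Sum.inr i) ↔ a = v ∧ i.val = 0 := Iff.rfl

@[simp] lemma attachPath_adj_inr_inl {a : V} {i : Fin r} :
    (H.attachPath v r).Adj (Sum.inr i) (Sum.inl a) ↔ a = v ∧ i.val = 0 := Iff.rfl

@[simp] lemma attachPath_adj_inr_inr {i j : Fin r} :
    (H.attachPath v r).Adj (Sum.inr i) (Sum.inr j) ↔
      i.val + 1 = j.val ∨ j.val + 1 = i.val := pathGraph_adj

lemma _root_.Fin.sum_ite_val_eq (r k : ℕ) :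
    (∑ i : Fin r, if i.val = k then 1 else 0) = if k < r then 1 else 0 := by
  rw [Fin.sum_univ_eq_sum_range (fun i => if i = k then 1 else 0) r]
  simp

lemma degree_attachPath_inl [Fintype V] (a : V) :
    (H.attachPath v r).degree (Sum.inl a) = H.degree a + if a = v ∧ 0 < r then 1 else 0 := by
  rw [degree_eq_sum_ite, Fintype.sum_sum_type, degree_eq_sum_ite]
  simp only [attachPath_adj_inl_inl, attachPath_adj_inl_inr]
  congr 1
  by_cases h : a = v
  · simp only [h, true_and]
    exact Fin.sum_ite_val_eq r 0
  · simp [h]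

lemma degree_attachPath_inr [Fintype V] (i : Fin r) :
    (H.attachPath v r).degree (Sum.inr i) = 1 + if i.val + 1 < r then 1 else 0 := by
  rw [degree_eq_sum_ite, Fintype.sum_sum_type]
  simp only [attachPath_adj_inr_inl, attachPath_adj_inr_inr]
  -- The guard `0 < i.val` protects the truncated subtraction; for `i = 0` the predecessor is `v`,
  -- counted in the other summand.
  have hsplit : ∀ j : Fin r, (if i.val + 1 = j.val ∨ j.val + 1 = i.val then 1 else 0) =
      (if j.val = i.val + 1 then 1 else 0) +
        if 0 < i.val then (if j.val = i.val - 1 then 1 else 0) else 0 := by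
    intro j; split_ifs <;> omega
  simp_rw [hsplit]
  rw [Finset.sum_add_distrib, Fin.sum_ite_val_eq]
  have hi := i.2
  by_cases h : i.val = 0
  · simp [h]
  · have hp : 0 < i.val := by omega
    simp only [h, and_false, if_false, Finset.sum_const_zero, hp, if_true, Fin.sum_ite_val_eq,
      show i.val - 1 < r by omega]
    omega

lemma Connected.attachPath (hH : H.Connected) : (H.attachPath v r).Connected := by
  have hinl : ∀ a b, (H.attachPath v r).Reachable (Sum.inl a) (Sum.inl b) := by
    intro a b
    exact (hH.preconnected a b).map (⟨Sum.inl, fun h => h⟩ : H →g H.attachPath v r)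
  have hinr : ∀ (k : ℕ) (hk : k < r),
      (H.attachPath v r).Reachable (Sum.inl v) (Sum.inr ⟨k, hk⟩) := by
    intro k
    induction k with
    | zero => intro hk; exact Adj.reachable (by simp)
    | succ k ih => intro hk; exact (ih (by omega)).trans (Adj.reachable (by simp))
  rw [connected_iff_exists_forall_reachable]
  refine ⟨Sum.inl v, ?_⟩
  rintro (a | ⟨k, hk⟩)
  · exact hinl v a
  · exact hinr k hk

/-- The attachment adds `r` edges along with `r` vertices, so the balance of edges and vertices is
kept. -/
lemma sum_degree_attachPath [Fintype V] (hr : 1 ≤ r) :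
    ∑ x, (H.attachPath v r).degree x = (∑ a, H.degree a) + 2 * r := by
  rw [Fintype.sum_sum_type]
  simp only [degree_attachPath_inl, degree_attachPath_inr, Finset.sum_add_distrib]
  have h1 : (∑ a : V, if a = v ∧ 0 < r then 1 else 0) = 1 := by
    simp [show 0 < r by omega]
  have h2 : (∑ i : Fin r, if i.val + 1 < r then 1 else 0) = r - 1 := by
    rw [Fin.sum_univ_eq_sum_range (fun i => if i + 1 < r then 1 else 0) r]
    obtain ⟨s, rfl⟩ : ∃ s, r = s + 1 := ⟨r - 1, by omega⟩
    rw [Finset.sum_range_succ, Finset.sum_congr rfl (g := fun _ => 1)]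
    · simp
    · intro i hi; rw [Finset.mem_range] at hi; simp [hi]
  rw [h1, h2]
  simp
  omega

end attachPath

lemma degree_cycleGraph {n : ℕ} (hn : 3 ≤ n) (v : Fin n)
    [Fintype ((cycleGraph n).neighborSet v)] : (cycleGraph n).degree v = 2 := by
  obtain ⟨m, rfl⟩ : ∃ m, n = m + 3 := ⟨n - 3, by omega⟩
  convert! cycleGraph_degree_three_le (v := v)

lemma connected_cycleGraph {n : ℕ} (hn : 1 ≤ n) : (cycleGraph n).Connected := by
  obtain ⟨m, rfl⟩ : ∃ m, n = m + 1 := ⟨n - 1, by omega⟩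
  exact cycleGraph_connected

lemma cycleGraph_adj_cases {n : ℕ} {u v : Fin n} (h : (cycleGraph n).Adj u v) :
    u.val + 1 = v.val ∨ v.val + 1 = u.val ∨
      (u.val = 0 ∧ v.val + 1 = n) ∨ (v.val = 0 ∧ u.val + 1 = n) := by
  have hne := h.ne
  rw [cycleGraph_adj'] at h
  have hu := u.2
  have hv := v.2
  rcases lt_or_gt_of_ne hne with huv | huv <;>
    (rw [Fin.coe_sub_iff_lt.2 huv, Fin.coe_sub_iff_le.2 huv.le] at h; omega)

/-- A longest path starting from `w` closes up a cycle if all other vertices have degree at least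
two. -/
lemma exists_path_closing {V : Type*} [Fintype V] (G : SimpleGraph V) {w : V}
    (hw : 0 < G.degree w) (hdeg : ∀ u, u ≠ w → 2 ≤ G.degree u) :
    ∃ (m j : ℕ) (x : ℕ → V), x 0 = w ∧ (∀ i < m, G.Adj (x i) (x (i + 1))) ∧
      Set.InjOn x (Set.Iic m) ∧ j + 2 ≤ m ∧ G.Adj (x m) (x j) := by
  let Q : ℕ → Prop := fun m => ∃ x : ℕ → V, x 0 = w ∧ (∀ i < m, G.Adj (x i) (x (i + 1))) ∧
    Set.InjOn x (Set.Iic m)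
  have hbound : ∀ m, Q m → m ≤ Fintype.card V := by
    rintro m ⟨x, -, -, hx⟩
    have := Finset.card_le_card_of_injOn (s := Finset.Iic m) (t := Finset.univ) x (by simp)
      (by simpa using hx)
    simp at this
    omega
  have hQ0 : Q 0 := ⟨fun _ => w, rfl, by simp, by
    intro a ha b hb _; simp at ha hb; omega⟩
  obtain ⟨m, ⟨x, hx0, hxa, hxi⟩, hmax⟩ : ∃ m, Q m ∧ ∀ k, Q k → k ≤ m :=
    ⟨Nat.findGreatest Q (Fintype.card V), Nat.findGreatest_spec (Nat.zero_le _) hQ0,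
      fun k hk => Nat.le_findGreatest (hbound k hk) hk⟩
  -- By maximality of `m`, a neighbor of the last vertex outside the path would extend it.
  have hclosed : ∀ y, G.Adj (x m) y → ∃ i ≤ m, x i = y := by
    intro y hy
    by_contra! hne
    have : Q (m + 1) := by
      refine ⟨fun i => if i ≤ m then x i else y, by simpa using hx0, ?_, ?_⟩
      · intro i hi
        rcases Nat.lt_succ_iff_lt_or_eq.1 hi with h | rfl
        · simpa [h.le, Nat.succ_le_of_lt h] using hxa i h
        · simpa using hy
      · intro a ha b hb hab
        simp only [Set.mem_Iic] at ha hb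
        dsimp only at hab
        split_ifs at hab with h1 h2 h2
        · exact hxi h1 h2 hab
        · exact absurd hab (hne a h1)
        · exact absurd hab.symm (hne b h2)
        · omega
    have := hmax _ this
    omega
  have hm : m ≠ 0 := by
    rintro rfl
    obtain ⟨y, hy⟩ := (G.degree_pos_iff_exists_adj w).1 hw
    obtain ⟨i, hi, rfl⟩ := hclosed y (by rwa [hx0])
    obtain rfl : i = 0 := by omega
    rw [hx0] at hy
    exact G.loopless.irrefl w hy
  have hxm : x m ≠ w := by
    rw [← hx0]
    intro h
    exact hm (hxi (by simp) (by simp) h)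
  obtain ⟨y, hy, hne⟩ : ∃ y ∈ G.neighborFinset (x m), y ≠ x (m - 1) :=
    Finset.exists_mem_ne (by rw [card_neighborFinset_eq_degree]; have := hdeg _ hxm; omega) _
  rw [mem_neighborFinset] at hy
  obtain ⟨j, hj, rfl⟩ := hclosed y hy
  refine ⟨m, j, x, hx0, hxa, hxi, ?_, hy⟩
  have h1 : j ≠ m := by rintro rfl; exact G.loopless.irrefl _ hy
  have h2 : j ≠ m - 1 := by rintro rfl; exact hne rfl
  omega

/-- A path whose last vertex is adjacent to its `j`-th vertex is the image of a cycle with an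
attached path with `j` vertices. -/
lemma exists_hom_of_path_closing {V : Type*} {G : SimpleGraph V} {m j : ℕ} {x : ℕ → V}
    (hadj : ∀ i < m, G.Adj (x i) (x (i + 1))) (hinj : Set.InjOn x (Set.Iic m)) (hj : j + 2 ≤ m)
    (hclose : G.Adj (x m) (x j)) :
    ∃ f : (cycleGraph (m - j + 1)).attachPath 0 j →g G, Function.Injective f ∧
      (∀ a, f (Sum.inl a) = x (j + a.val)) ∧ ∀ i, f (Sum.inr i) = x (j - 1 - i.val) := by
  -- The cycle occupies positions `j` to `m`, closed by the edge from `x m` to `x j`; the attached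
  -- path runs backwards from position `j - 1` to the start `0`.
  let g : Fin (m - j + 1) ⊕ Fin j → ℕ := Sum.elim (fun a => j + a.val) (fun i => j - 1 - i.val)
  have hg : ∀ a, g a ≤ m := by
    rintro (⟨a, ha⟩ | ⟨a, ha⟩) <;> simp only [g, Sum.elim_inl, Sum.elim_inr] <;> omega
  have hginj : Function.Injective g := by
    rintro (⟨a, ha⟩ | ⟨a, ha⟩) (⟨b, hb⟩ | ⟨b, hb⟩) h <;>
      simp only [g, Sum.elim_inl, Sum.elim_inr, Sum.inl.injEq, Sum.inr.injEq, Fin.mk.injEq,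
        reduceCtorEq] at h ⊢ <;> omega
  have hstep : ∀ {p q : ℕ}, p ≤ m → q ≤ m → p + 1 = q ∨ q + 1 = p → G.Adj (x p) (x q) := by
    rintro p q hp hq (rfl | rfl)
    · exact hadj p (by omega)
    · exact (hadj q (by omega)).symm
  have hmap : ∀ {a b}, ((cycleGraph (m - j + 1)).attachPath 0 j).Adj a b →
      G.Adj (x (g a)) (x (g b)) := by
    rintro (⟨a, ha⟩ | ⟨a, ha⟩) (⟨b, hb⟩ | ⟨b, hb⟩) h
    · rcases cycleGraph_adj_cases (attachPath_adj_inl_inl.1 h) with h | h | ⟨h, h'⟩ | ⟨h, h'⟩ <;>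
        dsimp only at h
      · exact hstep (hg _) (hg _) (by simp [g]; omega)
      · exact hstep (hg _) (hg _) (by simp [g]; omega)
      · dsimp only at h'
        have h1 : g (Sum.inl ⟨a, ha⟩) = j := by simp [g, h]
        have h2 : g (Sum.inl ⟨b, hb⟩) = m := by simp [g]; omega
        rw [h1, h2]; exact hclose.symm
      · dsimp only at h'
        have h1 : g (Sum.inl ⟨b, hb⟩) = j := by simp [g, h]
        have h2 : g (Sum.inl ⟨a, ha⟩) = m := by simp [g]; omega
        rw [h1, h2]; exact hclose
    · obtain ⟨h1, h2⟩ := attachPath_adj_inl_inr.1 h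
      rw [Fin.ext_iff] at h1
      simp at h1 h2
      exact hstep (hg _) (hg _) (by simp [g]; omega)
    · obtain ⟨h1, h2⟩ := attachPath_adj_inr_inl.1 h
      rw [Fin.ext_iff] at h1
      simp at h1 h2
      exact hstep (hg _) (hg _) (by simp [g]; omega)
    · have := attachPath_adj_inr_inr.1 h
      exact hstep (hg _) (hg _) (by simp [g] at this ⊢; omega)
  exact ⟨⟨x ∘ g, hmap⟩, fun a b h => hginj (hinj (hg a) (hg b) h), fun _ => rfl, fun _ => rfl⟩

end
end SimpleGraph

/-! ### Classification by degrees, and values of the index -/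

namespace SimpleGraph

section
open Classical

variable {V : Type*} [Fintype V] {G : SimpleGraph V} {α : ℝ}

lemma degree_le_of_injective {W : Type*} [Fintype W] {H : SimpleGraph W} (f : H →g G)
    (hf : Function.Injective f) (a : W) : H.degree a ≤ G.degree (f a) := by
  rw [← card_neighborFinset_eq_degree, ← card_neighborFinset_eq_degree]
  refine Finset.card_le_card_of_injOn f ?_ hf.injOn
  intro b hb
  rw [Finset.mem_coe, mem_neighborFinset] at hb ⊢
  exact f.map_adj hb

theorem isUnicyclic_iff_sum_degree :
    G.IsUnicyclic ↔ G.Connected ∧ ∑ v, G.degree v = 2 * Fintype.card V := by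
  rw [isUnicyclic_iff, sum_degrees_eq_twice_card_edges, Nat.card_eq_fintype_card,
    Nat.card_eq_fintype_card, edgeFinset_card]
  have : Fintype.card G.edgeSet = Fintype.card V ↔
      2 * Fintype.card G.edgeSet = 2 * Fintype.card V := by omega
  rw [this]

lemma IsUnicyclic.card_edgeFinset (hG : G.IsUnicyclic) :
    G.edgeFinset.card = Fintype.card V := by
  have := (isUnicyclic_iff_sum_degree.1 hG).2
  rw [sum_degrees_eq_twice_card_edges] at this
  omega

lemma IsUnicyclic.sumConnectivity_eq_sub (hG : G.IsUnicyclic) (hn : 2 ≤ Fintype.card V) :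
    G.sumConnectivity α = Fintype.card V * 4 ^ α - ∑ e ∈ G.edgeFinset, G.degreeGap α e :=
  SimpleGraph.sumConnectivity_eq_sub α (hG.1.degree_pos' hn) hG.card_edgeFinset

/-- A finite graph in which the degrees sum to twice the number of vertices is either two-regular
or has a vertex of degree at least three. -/
lemma degree_eq_two_or_exists_three_le (hsum : ∑ v, G.degree v = 2 * Fintype.card V) :
    (∀ v, G.degree v = 2) ∨ ∃ v, 3 ≤ G.degree v := by
  by_cases h : ∃ v, 3 ≤ G.degree v
  · exact Or.inr h
  · left
    push Not at h
    have hle : ∀ v ∈ Finset.univ, G.degree v ≤ 2 := fun v _ => by have := h v; omega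
    have := (Finset.sum_eq_sum_iff_of_le hle).1 (by rw [hsum]; simp [mul_comm])
    exact fun v => this v (Finset.mem_univ v)

/-- A connected two-regular graph is a cycle. -/
lemma Connected.nonempty_iso_cycleGraph (hG : G.Connected) (hdeg : ∀ v, G.degree v = 2) :
    Nonempty (G ≃g cycleGraph (Fintype.card V)) := by
  obtain ⟨w⟩ := hG.nonempty
  obtain ⟨m, j, x, -, hxa, hxi, hj, hc⟩ :=
    exists_path_closing G (w := w) (by rw [hdeg]; norm_num) fun u _ => (hdeg u).ge
  obtain ⟨f, hf, -, -⟩ := exists_hom_of_path_closing hxa hxi hj hc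
  have hcyc : ∀ (a : Fin (m - j + 1)) [Fintype ((cycleGraph (m - j + 1)).neighborSet a)],
      (cycleGraph (m - j + 1)).degree a = 2 := fun a _ => degree_cycleGraph (by omega) a
  -- The cycle part alone already has all degrees two, so it fills `G` whatever `j` is.
  let g : cycleGraph (m - j + 1) →g G := ⟨fun a => f (Sum.inl a), fun h => f.map_adj h⟩
  obtain ⟨e⟩ := hG.nonempty_iso_of_injective g (fun a b h => Sum.inl_injective (hf h))
    fun a => by rw [hdeg, hcyc]
  have hcard : Fintype.card V = m - j + 1 := by simpa using Fintype.card_congr e.toEquiv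
  rw [hcard]
  exact ⟨e⟩

/-- If a single vertex has degree three, all others have degree at most two, and the degrees sum to
twice the number of vertices, then there is exactly one leaf. -/
lemma exists_leaf_forall_two_le_degree (hpos : ∀ v, 0 < G.degree v)
    (hsum : ∑ v, G.degree v = 2 * Fintype.card V) {v : V} (hv : G.degree v = 3)
    (hle : ∀ u, u ≠ v → G.degree u ≤ 2) :
    ∃ w, G.degree w = 1 ∧ ∀ u, u ≠ w → 2 ≤ G.degree u := by
  obtain ⟨w, hw⟩ : ∃ w, G.degree w < 2 := by
    by_contra! h
    have : ∑ _u : V, 2 < ∑ u, G.degree u :=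
      Finset.sum_lt_sum (fun u _ => h u) ⟨v, Finset.mem_univ v, by omega⟩
    rw [hsum] at this
    simp [mul_comm] at this
  refine ⟨w, by have := hpos w; omega, fun u huw => ?_⟩
  by_contra! hu
  -- Two vertices of degree below two would bring the degree sum down to at most `2n + 1 - 2`.
  have hbound : ∀ a ∈ Finset.univ, (G.degree a : ℤ) ≤
      2 + (if a = v then 1 else 0) - (if a = w then 1 else 0) - (if a = u then 1 else 0) := by
    intro a _
    by_cases hav : a = v
    · have h1 : a ≠ w := by rintro rfl; rw [hav] at hw; omega
      have h2 : a ≠ u := by rintro rfl; rw [hav] at hu; omega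
      rw [if_pos hav, if_neg h1, if_neg h2, hav, hv]; norm_num
    · have := hle a hav
      by_cases haw : a = w
      · have h2 : a ≠ u := by rintro rfl; exact huw haw
        subst haw
        simp only [hav, h2, if_true, if_false]; omega
      · by_cases hau : a = u
        · subst hau
          simp only [hav, haw, if_true, if_false]; omega
        · simp only [hav, haw, hau, if_false]; omega
  have h := Finset.sum_le_sum hbound
  rw [← Nat.cast_sum, hsum] at h
  simp [Finset.sum_add_distrib, Finset.sum_sub_distrib] at h
  omega

/-- A connected graph with one vertex of degree three, all other degrees at most two, and as many
edges as vertices is a cycle with an attached path. -/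
lemma Connected.exists_iso_attachPath (hG : G.Connected) (hn : 2 ≤ Fintype.card V)
    (hsum : ∑ v, G.degree v = 2 * Fintype.card V) {v : V} (hv : G.degree v = 3)
    (hle : ∀ u, u ≠ v → G.degree u ≤ 2) :
    ∃ k r, 2 ≤ k ∧ 1 ≤ r ∧ Nonempty (G ≃g (cycleGraph (k + 1)).attachPath 0 r) := by
  obtain ⟨w, hw, hdeg⟩ := exists_leaf_forall_two_le_degree (hG.degree_pos' hn) hsum hv hle
  obtain ⟨m, j, x, hx0, hxa, hxi, hj, hc⟩ :=
    exists_path_closing G (w := w) (by rw [hw]; norm_num) hdeg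
  obtain ⟨f, hf, hfl, hfr⟩ := exists_hom_of_path_closing hxa hxi hj hc
  have hcyc : ∀ (a : Fin (m - j + 1)) [Fintype ((cycleGraph (m - j + 1)).neighborSet a)],
      (cycleGraph (m - j + 1)).degree a = 2 := fun a _ => degree_cycleGraph (by omega) a
  have h0 := degree_le_of_injective f hf (Sum.inl 0)
  rw [degree_attachPath_inl, hcyc] at h0
  -- If `j = 0`, the leaf `w` itself would lie on the cycle.
  have hj0 : 0 < j := by
    by_contra! h
    obtain rfl : j = 0 := by omega
    rw [hfl, Fin.val_zero, add_zero, hx0, hw] at h0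
    omega
  simp only [hj0, and_self, if_true] at h0
  have hv0 : f (Sum.inl 0) = v := by
    by_contra h
    have := hle _ h
    omega
  refine ⟨m - j, j, by omega, hj0, hG.nonempty_iso_of_injective f hf ?_⟩
  rintro (a | i)
  · rw [degree_attachPath_inl, hcyc]
    by_cases ha : a = 0
    · subst ha; rw [hv0, hv]; simp [hj0]
    · have : f (Sum.inl a) ≠ v := by
        rw [← hv0]; exact fun h => ha (Sum.inl_injective (hf h))
      have := hle _ this
      omega
  · rw [degree_attachPath_inr]
    by_cases hi : i.val + 1 < j
    · have : f (Sum.inr i) ≠ v := by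
        rw [← hv0]; exact fun h => by simpa using hf h
      have := hle _ this
      simpa [hi] using this
    · have hi2 := i.2
      have : j - 1 - i.val = 0 := by omega
      rw [hfr, this, hx0, hw]
      omega

/-- The degrees of a cycle with an attached path. -/
lemma degree_of_iso_attachPath {l r : ℕ} {c : Fin l} (hl : 3 ≤ l) (hr : 1 ≤ r)
    (e : G ≃g (cycleGraph l).attachPath c r) :
    G.IsUnicyclic ∧ ∃ v, G.degree v = 3 ∧ (∀ u, u ≠ v → G.degree u ≤ 2) ∧
      (2 ≤ r → ∀ u, G.Adj v u → G.degree u = 2) := by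
  have hdeg : ∀ u, G.degree u = ((cycleGraph l).attachPath c r).degree (e u) :=
    fun u => (e.degree_eq u).symm
  have hcyc : ∀ (a : Fin l) [Fintype ((cycleGraph l).neighborSet a)],
      (cycleGraph l).degree a = 2 := fun a _ => degree_cycleGraph hl a
  refine ⟨isUnicyclic_iff_sum_degree.2 ⟨?_, ?_⟩, e.symm (Sum.inl c), ?_, ?_, ?_⟩
  · exact e.connected_iff.2 (connected_cycleGraph (by omega)).attachPath
  · have h1 : ∑ u, G.degree u = ∑ x, ((cycleGraph l).attachPath c r).degree x := by
      rw [← Equiv.sum_comp e.toEquiv]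
      exact Finset.sum_congr rfl fun u _ => hdeg u
    rw [h1, sum_degree_attachPath hr, Fintype.card_congr e.toEquiv]
    simp [hcyc]
    ring
  · rw [hdeg, RelIso.apply_symm_apply, degree_attachPath_inl, hcyc]
    simp [show 0 < r by omega]
  · intro u hu
    rw [hdeg]
    have hne : e u ≠ Sum.inl c := fun h => hu (by rw [← h, RelIso.symm_apply_apply])
    generalize e u = x at hne ⊢
    rcases x with a | i
    · have : a ≠ c := fun h => hne (by rw [h])
      rw [degree_attachPath_inl, hcyc]
      simp [this]
    · rw [degree_attachPath_inr]
      split_ifs <;> omega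
  · intro hr2 u hu
    have hadj : ((cycleGraph l).attachPath c r).Adj (Sum.inl c) (e u) := by
      have := e.map_adj_iff.2 hu
      rwa [RelIso.apply_symm_apply] at this
    rw [hdeg]
    generalize e u = x at hadj ⊢
    rcases x with a | i
    · have : a ≠ c := (attachPath_adj_inl_inl.1 hadj).ne'
      rw [degree_attachPath_inl, hcyc]
      simp [this]
    · have hi := (attachPath_adj_inl_inr.1 hadj).2
      rw [degree_attachPath_inr, hi]
      simp [show 1 < r by omega]

lemma degree_of_iso_cycleGraph {n : ℕ} (hn : 3 ≤ n) (e : G ≃g cycleGraph n) :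
    G.IsUnicyclic ∧ ∀ v, G.degree v = 2 := by
  have hdeg : ∀ v, G.degree v = 2 := fun v => by
    rw [← e.degree_eq v]; exact degree_cycleGraph hn _
  refine ⟨isUnicyclic_iff_sum_degree.2 ⟨?_, ?_⟩, hdeg⟩
  · exact e.connected_iff.2 (connected_cycleGraph (by omega))
  · simp [hdeg, mul_comm]

lemma IsUnicyclic.sumConnectivity_of_degree_eq_two (hG : G.IsUnicyclic)
    (hn : 2 ≤ Fintype.card V) (hdeg : ∀ v, G.degree v = 2) :
    G.sumConnectivity α = Fintype.card V * 4 ^ α := by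
  rw [hG.sumConnectivity_eq_sub hn, Finset.sum_eq_zero, sub_zero]
  intro e _
  induction e with
  | h x y => rw [degreeGap_mk, hdeg, hdeg]; exact_mod_cast edgeGap_two_two α

lemma IsUnicyclic.sumConnectivity_le (hα : -1 ≤ α) (hα0 : α < 0) (hG : G.IsUnicyclic)
    (hn : 3 ≤ Fintype.card V) {v : V} (hv : 3 ≤ G.degree v) :
    G.sumConnectivity α ≤ Fintype.card V * 4 ^ α - 3 * edgeGap α 3 2 := by
  rw [hG.sumConnectivity_eq_sub (by omega)]
  have h1 := three_mul_edgeGap_le_sum hα hα0 (hG.1.degree_pos' (by omega)) hv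
  have h2 := sum_incidenceFinset_degreeGap_le hα hα0 hG.1 hn v
  linarith

lemma IsUnicyclic.sumConnectivity_eq_of_degree (hG : G.IsUnicyclic) (hn : 3 ≤ Fintype.card V)
    {v : V} (hle : ∀ u, u ≠ v → G.degree u ≤ 2) :
    G.sumConnectivity α = Fintype.card V * 4 ^ α -
      ∑ w ∈ G.neighborFinset v, edgeGap α (G.degree v) (G.degree w) := by
  rw [hG.sumConnectivity_eq_sub (by omega),
    sum_edgeFinset_degreeGap_eq_sum_incidenceFinset hG.1 hn hle, sum_incidenceFinset]
  rfl

lemma exists_iso_attachPath_of_le_sumConnectivity (hα : -1 ≤ α) (hα0 : α < 0) (hG : G.IsUnicyclic)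
    (hn : 3 ≤ Fintype.card V) {v : V} (hv : 3 ≤ G.degree v)
    (hge : Fintype.card V * 4 ^ α - 3 * edgeGap α 3 2 ≤ G.sumConnectivity α) :
    ∃ k r, 2 ≤ k ∧ 2 ≤ r ∧ Nonempty (G ≃g (cycleGraph (k + 1)).attachPath 0 r) := by
  rw [hG.sumConnectivity_eq_sub (by omega)] at hge
  obtain ⟨h3, h2, hle⟩ := degree_eq_of_sum_edgeFinset_le hα hα0 hG.1 hn hv (by linarith)
  obtain ⟨k, r, hk, hr, ⟨e⟩⟩ := hG.1.exists_iso_attachPath (by omega)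
    (isUnicyclic_iff_sum_degree.1 hG).2 h3 hle
  refine ⟨k, r, hk, ?_, ⟨e⟩⟩
  -- With `r = 1` the attached leaf is a neighbor of `v`, whose neighbors all have degree two.
  by_contra! hr2
  obtain rfl : r = 1 := by omega
  have hd0 : G.degree (e.symm (Sum.inl 0)) = 3 := by
    rw [e.symm.degree_eq, degree_attachPath_inl,
      degree_cycleGraph (n := k + 1) (by omega)]
    simp
  have hd1 : G.degree (e.symm (Sum.inr 0)) = 1 := by
    rw [e.symm.degree_eq, degree_attachPath_inr]
    simp
  have hv0 : e.symm (Sum.inl 0) = v := by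
    by_contra h
    have := hle _ h
    omega
  have hadj : G.Adj (e.symm (Sum.inl 0)) (e.symm (Sum.inr 0)) :=
    e.symm.map_adj_iff.2 (by simp)
  have := h2 _ (hv0 ▸ hadj)
  omega

lemma sumConnectivity_of_iso_attachPath {l r : ℕ} {c : Fin l} (hl : 3 ≤ l) (hr : 2 ≤ r)
    (e : G ≃g (cycleGraph l).attachPath c r) :
    G.sumConnectivity α = Fintype.card V * 4 ^ α - 3 * edgeGap α 3 2 := by
  obtain ⟨hG, v, hv, hle, h2⟩ := degree_of_iso_attachPath hl (by omega) e
  have hcard : Fintype.card V = l + r := by simpa using Fintype.card_congr e.toEquiv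
  rw [hG.sumConnectivity_eq_of_degree (by omega) hle,
    Finset.sum_congr rfl (g := fun _ => edgeGap α 3 2)]
  · simp [hv]
  · intro w hw
    rw [hv, h2 hr w ((G.mem_neighborFinset v w).1 hw)]
    norm_num

lemma adj_of_degree_add_one_eq_card {u v : V} (hv : G.degree v + 1 = Fintype.card V)
    (huv : u ≠ v) : G.Adj v u := by
  have : G.neighborFinset v = Finset.univ.erase v := by
    refine Finset.eq_of_subset_of_card_le ?_ ?_
    · intro w hw
      rw [mem_neighborFinset] at hw
      simp [hw.ne']
    · rw [Finset.card_erase_of_mem (Finset.mem_univ v), Finset.card_univ,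
        card_neighborFinset_eq_degree]
      omega
  rw [← mem_neighborFinset, this]
  simp [huv]

/-- A unicyclic graph on four vertices other than the cycle has one vertex of degree three, the
other degrees being at most two. -/
lemma IsUnicyclic.degree_of_card_eq_four (hG : G.IsUnicyclic) (hn : Fintype.card V = 4) {v : V}
    (hv : 3 ≤ G.degree v) : G.degree v = 3 ∧ ∀ u, u ≠ v → G.degree u ≤ 2 := by
  have hlt : ∀ u, G.degree u < 4 := fun u => hn ▸ G.degree_lt_card_verts u
  have hv3 : G.degree v = 3 := by have := hlt v; omega
  refine ⟨hv3, fun u huv => ?_⟩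
  by_contra! hu
  have hu3 : G.degree u = 3 := by have := hlt u; omega
  -- Two vertices of degree three are adjacent to all others, so the remaining two have degree at
  -- least two and the degree sum is at least 10 instead of 8.
  have hbound : ∀ a ∈ Finset.univ,
      2 + (if a = v then 1 else 0) + (if a = u then 1 else 0) ≤ G.degree a := by
    intro a _
    by_cases hav : a = v
    · subst hav; simp [huv.symm, hv3]
    by_cases hau : a = u
    · subst hau; simp [huv, hu3]
    simp only [hav, hau, if_false, add_zero]
    rw [← card_neighborFinset_eq_degree, ← Finset.card_pair huv]
    refine Finset.card_le_card ?_
    have h1 := adj_of_degree_add_one_eq_card (G := G) (by omega) hav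
    have h2 := adj_of_degree_add_one_eq_card (G := G) (by omega) hau
    intro b hb
    rw [mem_neighborFinset]
    rcases Finset.mem_insert.1 hb with rfl | hb
    · exact h2.symm
    · rw [Finset.mem_singleton.1 hb]; exact h1.symm
  have h := Finset.sum_le_sum hbound
  rw [(isUnicyclic_iff_sum_degree.1 hG).2] at h
  simp [Finset.sum_add_distrib, hn] at h

lemma IsUnicyclic.iso_of_card_eq_four (hG : G.IsUnicyclic) (hn : Fintype.card V = 4) {v : V}
    (hv : 3 ≤ G.degree v) : Nonempty (G ≃g (cycleGraph 3).attachPath 0 1) := by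
  obtain ⟨h3, hle⟩ := hG.degree_of_card_eq_four hn hv
  obtain ⟨k, r, hk, hr, ⟨e⟩⟩ := hG.1.exists_iso_attachPath (by omega)
    (isUnicyclic_iff_sum_degree.1 hG).2 h3 hle
  have hcard : Fintype.card V = k + 1 + r := by simpa using Fintype.card_congr e.toEquiv
  obtain rfl : k = 2 := by omega
  obtain rfl : r = 1 := by omega
  exact ⟨e⟩

/-- The slack is `2 * edgeGap α 3 2 + edgeGap α 3 1`, from the two triangle edges and the pendant
edge at the vertex of degree three. -/
lemma sumConnectivity_of_iso_attachPath_three_one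
    (e : G ≃g (cycleGraph 3).attachPath 0 1) :
    G.sumConnectivity α = 2 * 4 ^ α + 2 * 5 ^ α := by
  obtain ⟨hG, v, hv, hle, -⟩ := degree_of_iso_attachPath le_rfl le_rfl e
  have hcard : Fintype.card V = 4 := by simpa using Fintype.card_congr e.toEquiv
  obtain ⟨w, hw, hdeg⟩ := exists_leaf_forall_two_le_degree (hG.1.degree_pos' (by omega))
    (isUnicyclic_iff_sum_degree.1 hG).2 hv hle
  have hwv : w ≠ v := by rintro rfl; omega
  have hmem : w ∈ G.neighborFinset v :=
    (G.mem_neighborFinset v w).2 (adj_of_degree_add_one_eq_card (by omega) hwv)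
  have hrest : ∀ u ∈ (G.neighborFinset v).erase w,
      edgeGap α (G.degree v) (G.degree u) = edgeGap α 3 2 := by
    intro u hu
    rw [Finset.mem_erase, mem_neighborFinset] at hu
    have h1 := hle u hu.2.ne'
    have h2 := hdeg u hu.1
    rw [hv, show G.degree u = 2 by omega]
    norm_num
  rw [hG.sumConnectivity_eq_of_degree (by omega) hle, ← Finset.add_sum_erase _ _ hmem,
    Finset.sum_congr rfl hrest, Finset.sum_const, Finset.card_erase_of_mem hmem,
    card_neighborFinset_eq_degree, hv, hw, hcard]
  push_cast
  rw [edgeGap_three_one, edgeGap_three_two]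
  norm_num
  ring

lemma exists_iso_of_card_eq {W : Type*} [Fintype W] (H : SimpleGraph W)
    (h : Fintype.card V = Fintype.card W) : ∃ G : SimpleGraph V, Nonempty (G ≃g H) :=
  ⟨_, ⟨Iso.comap (Fintype.equivOfCardEq h) H⟩⟩

end
end SimpleGraph

/-! ### The maximum and the second maximum -/

theorem theorem2p3 (α : ℝ) (hα : -1 ≤ α) (hα0 : α < 0) (n : ℕ) (hn : 4 ≤ n)
    (V : Type*) [Fintype V] (hV : Fintype.card V = n) :
    (IsGreatest (unicyclicIndexValues V α) ((n : ℝ) * (4 : ℝ) ^ α) ∧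
      ∀ G : SimpleGraph V,
        (G.IsUnicyclic ∧ G.sumConnectivity α = (n : ℝ) * (4 : ℝ) ^ α) ↔
          Nonempty (G ≃g SimpleGraph.cycleGraph n)) ∧
    (n = 4 →
      IsSecondGreatest (unicyclicIndexValues V α) (2 * (4 : ℝ) ^ α + 2 * (5 : ℝ) ^ α) ∧
      ∀ G : SimpleGraph V,
        (G.IsUnicyclic ∧ G.sumConnectivity α = 2 * (4 : ℝ) ^ α + 2 * (5 : ℝ) ^ α) ↔
          Nonempty (G ≃g (SimpleGraph.cycleGraph 3).attachPath 0 1)) ∧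
    (5 ≤ n →
      IsSecondGreatest (unicyclicIndexValues V α)
        (((n : ℝ) - 4) * (4 : ℝ) ^ α + 3 * (5 : ℝ) ^ α + (3 : ℝ) ^ α) ∧
      ∀ G : SimpleGraph V,
        (G.IsUnicyclic ∧ G.sumConnectivity α =
            ((n : ℝ) - 4) * (4 : ℝ) ^ α + 3 * (5 : ℝ) ^ α + (3 : ℝ) ^ α) ↔
          ∃ (l r : ℕ) (v : Fin l), 3 ≤ l ∧ 2 ≤ r ∧
            Nonempty (G ≃g (SimpleGraph.cycleGraph l).attachPath v r)) := by
  classical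
  subst hV
  have hgap := edgeGap_three_two_pos hα hα0
  have hdich : ∀ G : SimpleGraph V, G.IsUnicyclic →
      (∀ v, G.degree v = 2) ∨ ∃ v, 3 ≤ G.degree v := fun G hG =>
    SimpleGraph.degree_eq_two_or_exists_three_le (SimpleGraph.isUnicyclic_iff_sum_degree.1 hG).2
  have hcycle : ∀ G : SimpleGraph V,
      (G.IsUnicyclic ∧ G.sumConnectivity α = (Fintype.card V : ℝ) * (4 : ℝ) ^ α) ↔
        Nonempty (G ≃g SimpleGraph.cycleGraph (Fintype.card V)) := by
    intro G
    constructor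
    · rintro ⟨hG, hval⟩
      rcases hdich G hG with h | ⟨v, hv⟩
      · exact hG.1.nonempty_iso_cycleGraph fun v => by convert h v
      · have := hG.sumConnectivity_le hα hα0 (by omega) (v := v) (by convert hv)
        linarith
    · rintro ⟨e⟩
      obtain ⟨hG, hdeg⟩ := SimpleGraph.degree_of_iso_cycleGraph (by omega) e
      exact ⟨hG, hG.sumConnectivity_of_degree_eq_two (by omega) hdeg⟩
  have hmax : IsGreatest (unicyclicIndexValues V α) ((Fintype.card V : ℝ) * (4 : ℝ) ^ α) := by
    constructor
    · obtain ⟨G, hG⟩ := SimpleGraph.exists_iso_of_card_eq (V := V)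
        (SimpleGraph.cycleGraph (Fintype.card V)) (by simp)
      exact ⟨G, (hcycle G).2 hG⟩
    · rintro _ ⟨G, hG, rfl⟩
      rcases hdich G hG with h | ⟨v, hv⟩
      · exact (hG.sumConnectivity_of_degree_eq_two (by omega) h).le
      · have := hG.sumConnectivity_le hα hα0 (by omega) hv
        linarith
  have hthree : ∀ G : SimpleGraph V, G.IsUnicyclic →
      G.sumConnectivity α ≠ (Fintype.card V : ℝ) * (4 : ℝ) ^ α → ∃ v, 3 ≤ G.degree v := by
    intro G hG hne
    rcases hdich G hG with h | h
    · exact absurd (hG.sumConnectivity_of_degree_eq_two (by omega) h) hne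
    · exact h
  refine ⟨⟨hmax, hcycle⟩, fun h4 => ?_, fun h5 => ?_⟩
  · have h45 : (5 : ℝ) ^ α < 4 ^ α :=
      Real.rpow_lt_rpow_of_neg (by norm_num) (by norm_num) hα0
    have hne : 2 * (4 : ℝ) ^ α + 2 * (5 : ℝ) ^ α ≠ (Fintype.card V : ℝ) * (4 : ℝ) ^ α := by
      rw [h4]; push_cast; linarith
    have hchar : ∀ G : SimpleGraph V,
        (G.IsUnicyclic ∧ G.sumConnectivity α = 2 * (4 : ℝ) ^ α + 2 * (5 : ℝ) ^ α) ↔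
          Nonempty (G ≃g (SimpleGraph.cycleGraph 3).attachPath 0 1) := by
      intro G
      constructor
      · rintro ⟨hG, hval⟩
        obtain ⟨v, hv⟩ := hthree G hG (hval ▸ hne)
        exact hG.iso_of_card_eq_four h4 hv
      · rintro ⟨e⟩
        exact ⟨(SimpleGraph.degree_of_iso_attachPath le_rfl le_rfl e).1,
          SimpleGraph.sumConnectivity_of_iso_attachPath_three_one e⟩
    refine ⟨⟨_, hmax, ⟨?_, hne⟩, ?_⟩, hchar⟩
    · obtain ⟨G, hG⟩ := SimpleGraph.exists_iso_of_card_eq (V := V)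
        ((SimpleGraph.cycleGraph 3).attachPath 0 1)
        (by simp [h4])
      exact ⟨G, (hchar G).2 hG⟩
    · rintro _ ⟨⟨G, hG, rfl⟩, hx⟩
      obtain ⟨v, hv⟩ := hthree G hG hx
      obtain ⟨e⟩ := hG.iso_of_card_eq_four h4 hv
      exact (SimpleGraph.sumConnectivity_of_iso_attachPath_three_one e).le
  · have hval : ((Fintype.card V : ℝ) - 4) * (4 : ℝ) ^ α + 3 * (5 : ℝ) ^ α + (3 : ℝ) ^ α =
        Fintype.card V * 4 ^ α - 3 * edgeGap α 3 2 := by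
      rw [edgeGap_three_two]; ring
    rw [hval]
    have hne : (Fintype.card V : ℝ) * 4 ^ α - 3 * edgeGap α 3 2 ≠
        (Fintype.card V : ℝ) * (4 : ℝ) ^ α := by linarith
    have hchar : ∀ G : SimpleGraph V,
        (G.IsUnicyclic ∧ G.sumConnectivity α = Fintype.card V * 4 ^ α - 3 * edgeGap α 3 2) ↔
          ∃ (l r : ℕ) (v : Fin l), 3 ≤ l ∧ 2 ≤ r ∧
            Nonempty (G ≃g (SimpleGraph.cycleGraph l).attachPath v r) := by
      intro G
      constructor
      · rintro ⟨hG, hval⟩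
        obtain ⟨v, hv⟩ := hthree G hG (hval ▸ hne)
        obtain ⟨k, r, hk, hr, he⟩ :=
          SimpleGraph.exists_iso_attachPath_of_le_sumConnectivity hα hα0 hG (by omega) hv hval.ge
        exact ⟨k + 1, r, 0, by omega, hr, he⟩
      · rintro ⟨l, r, c, hl, hr, ⟨e⟩⟩
        exact ⟨(SimpleGraph.degree_of_iso_attachPath hl (by omega) e).1,
          SimpleGraph.sumConnectivity_of_iso_attachPath hl hr e⟩
    refine ⟨⟨_, hmax, ⟨?_, hne⟩, ?_⟩, hchar⟩
    -- A triangle leaves `n - 3` vertices for the path, at least two exactly because `5 ≤ n`.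
    · obtain ⟨G, hG⟩ := SimpleGraph.exists_iso_of_card_eq (V := V)
        ((SimpleGraph.cycleGraph 3).attachPath 0 (Fintype.card V - 3)) (by simp; omega)
      exact ⟨G, (hchar G).2 ⟨3, _, 0, le_rfl, by omega, hG⟩⟩
    · rintro _ ⟨⟨G, hG, rfl⟩, hx⟩
      obtain ⟨v, hv⟩ := hthree G hG hx
      exact hG.sumConnectivity_le hα hα0 (by omega) hv
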